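/- Let $D\in\{2,3,4\}$, let $\eta=\mathrm{diag}(-1,1,\dots,1)$ be the $D\times D$ Minkowski matrix, and let $g=(g_{\mu\nu})$ and $f=(f_{\mu\nu})$ be two Lorentzian metrics at a point of a $D$-dimensional space-time, given by their components, i.e. real symmetric $D\times D$ matrices of signature $(-,+,\dots,+)$. Write $g^{\mu\nu}$ for the entries of $g^{-1}$; repeated indices are summed, and $L_{A\mu}=\eta_{AB}L^B{}_\mu$. Then there exist real vielbeins $e_A{}^\mu$ and $L^A{}_\mu$ corresponding to $g$ and $f$ respectively, i.e. $$\eta^{AB}e_A{}^\mu e_B{}^\nu=g^{\mu\nu},\qquad \eta_{AB}L^A{}_\mu L^B{}_\nu=f_{\mu\nu},$$ which satisfy the symmetry condition $e_A{}^\mu L_{B\mu}=e_B{}^\mu L_{A\mu}$ for all $A,B$, if and only if there exists a real $D\times D$ matrix $\gamma$ such that $\gamma^2=g^{-1}f$. Moreover, such a $\gamma$ exists if and only if there exists a real $D\times D$ matrix $\gamma$ such that $\gamma^2=g^{-1}f$ and $f\gamma$ is symmetric. -/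

import Mathlib

/-- The canonical Minkowski metric `η = diag(-1, 1, …, 1)` in `D` dimensions, as a matrix. It is its
own inverse, so it gives the components both of `η_{AB}` and of `η^{AB}`. -/
def minkowski (D : ℕ) : Matrix (Fin D) (Fin D) ℝ :=
  Matrix.diagonal fun A => if (A : ℕ) = 0 then -1 else 1

/-- The matrix of components `g_{μν}` (at a space-time point) of a Lorentzian metric: a real symmetric
matrix of signature `(-, +, …, +)`. Counted with multiplicity, exactly one eigenvalue is negative,
and all the others are positive. -/
def IsLorentzMetric {D : ℕ} (g : Matrix (Fin D) (Fin D) ℝ) : Prop :=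
  ∃ h : g.IsHermitian,
    ∃ i₀ : Fin D, h.eigenvalues i₀ < 0 ∧ ∀ i : Fin D, i ≠ i₀ → 0 < h.eigenvalues i

/-- `e A μ = e_A^μ` are the components of a vielbein (a frame of vectors) for the metric `g`:
`η^{AB} e_A^μ e_B^ν = g^{μν}`, where `g^{μν}` is the inverse of the matrix `g_{μν}`. -/
def IsFrameOf {D : ℕ} (e g : Matrix (Fin D) (Fin D) ℝ) : Prop :=
  ∀ μ ν, ∑ A, ∑ B, minkowski D A B * e A μ * e B ν = g⁻¹ μ ν

/-- `L A μ = L^A_μ` are the components of a vielbein (a coframe of 1-forms) for the metric `f`: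
`η_{AB} L^A_μ L^B_ν = f_{μν}`. -/
def IsCoframeOf {D : ℕ} (L f : Matrix (Fin D) (Fin D) ℝ) : Prop :=
  ∀ μ ν, ∑ A, ∑ B, minkowski D A B * L A μ * L B ν = f μ ν

/-- `L_{Aμ} = η_{AB} L^B_μ`: the Lorentz index of the coframe is lowered with `η`. -/
def lowered {D : ℕ} (L : Matrix (Fin D) (Fin D) ℝ) : Matrix (Fin D) (Fin D) ℝ :=
  fun A μ => ∑ B, minkowski D A B * L B μ

/-- The symmetry condition `e_A^μ L_{Bμ} = e_B^μ L_{Aμ}`. -/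
def SymmetricVielbeins {D : ℕ} (e L : Matrix (Fin D) (Fin D) ℝ) : Prop :=
  ∀ A B, ∑ μ, e A μ * lowered L B μ = ∑ μ, e B μ * lowered L A μ

/-!
Symmetric vielbeins `e`, `L` give the square root `γ = e_A^μ L^A_ν` of `g⁻¹ f`. Conversely, if `E` is
an orthonormal coframe of `g` and `γ` is a square root of `g⁻¹ f` that is self-adjoint for `g`, then
`E γ` is a coframe of `f`, and it is symmetric with respect to the frame dual to `E`. For a square
root `γ`, self-adjointness for `g` implies that `f γ = g γ³` is symmetric. So everything rests on
`exists_isSymm_sqrt`: if `A = g⁻¹ f` has a real square root, then it has one that is self-adjoint for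
`g`. The argument works in every dimension.

If `A` has no eigenvalue in `(-∞, 0]`, it has a square root that is a real polynomial in `A`
(`exists_aeval_mul_self_eq`), and polynomials in a self-adjoint matrix are self-adjoint.

Otherwise `A` has an eigenvector `v` with eigenvalue `μ < 0`, and if `γ² = A`, then `γ v` is a second,
linearly independent one. On the plane spanned by `v` and `γ v` the forms `f` and `μ g` agree. Both `g`
and `f` are Lorentzian and so take positive values on every plane, hence `g` has signature `(-, +)` on
this one (`exists_orthonormal_of_eq_smul`). On its orthogonal complement `g` and `f` are both positive
definite, so `A` has no eigenvalue in `(-∞, 0]` there. The plane has a `g`-self-adjoint complex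
structure `J`, sending an orthonormal basis `t`, `x` to `-x`, `t`; `√(-μ) J` on the plane and the
polynomial square root on the complement together are the required root
(`exists_isSymm_sqrt_of_plane`).
-/

/-! ### Polynomial square roots -/

open Polynomial in
/-- A form of the Nullstellensatz: `p` divides a power of any polynomial that vanishes at all complex
roots of `p`. -/
theorem dvd_pow_of_forall_aeval_eq_zero {p q : ℝ[X]} (hp : p ≠ 0)
    (h : ∀ z : ℂ, aeval z p = 0 → aeval z q = 0) : p ∣ q ^ p.natDegree := by
  rcases eq_or_ne q 0 with rfl | hq
  · rcases Nat.eq_zero_or_pos p.natDegree with h0 | h0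
    · have hu : IsUnit p := isUnit_iff_degree_eq_zero.2 (by rw [degree_eq_natDegree hp, h0]; rfl)
      exact hu.dvd
    · rw [zero_pow h0.ne']
      exact dvd_zero p
  rw [← map_dvd_map' (algebraMap ℝ ℂ), Polynomial.map_pow]
  have hp' : p.map (algebraMap ℝ ℂ) ≠ 0 := (Polynomial.map_ne_zero_iff
    (algebraMap ℝ ℂ).injective).2 hp
  have hq' : q.map (algebraMap ℝ ℂ) ≠ 0 := (Polynomial.map_ne_zero_iff
    (algebraMap ℝ ℂ).injective).2 hq
  refine (IsAlgClosed.splits _).dvd_of_roots_le_roots hp' ?_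
  rw [roots_pow, Multiset.le_iff_count]
  intro z
  rw [Multiset.count_nsmul]
  by_cases hz : z ∈ (p.map (algebraMap ℝ ℂ)).roots
  · have hz' : z ∈ (q.map (algebraMap ℝ ℂ)).roots := by
      rw [mem_roots hq', IsRoot, eval_map_algebraMap]
      rw [mem_roots hp', IsRoot, eval_map_algebraMap] at hz
      exact h z hz
    have h1 : (p.map (algebraMap ℝ ℂ)).roots.count z ≤ p.natDegree :=
      (Multiset.count_le_card _ _).trans ((card_roots' _).trans natDegree_map_le)
    exact h1.trans (Nat.le_mul_of_pos_right _ (Multiset.count_pos.2 hz'))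
  · rw [Multiset.count_eq_zero_of_notMem hz]
    exact Nat.zero_le _

open Polynomial in
/-- A conjugation-equivariant function on `ℂ` is interpolated by a real polynomial at the complex
roots of a real polynomial. -/
theorem exists_real_interpolation {p : ℝ[X]} (hp : p ≠ 0) (s : ℂ → ℂ)
    (hs : ∀ z, aeval z p = 0 → s (starRingEnd ℂ z) = starRingEnd ℂ (s z)) :
    ∃ r : ℝ[X], ∀ z, aeval z p = 0 → aeval z r = s z := by
  have hp' : p.map (algebraMap ℝ ℂ) ≠ 0 := (Polynomial.map_ne_zero_iff
    (algebraMap ℝ ℂ).injective).2 hp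
  set S := (p.map (algebraMap ℝ ℂ)).roots.toFinset with hS
  have hmem : ∀ z, aeval z p = 0 → z ∈ S := fun z hz => by
    rw [hS, Multiset.mem_toFinset, mem_roots hp', IsRoot, eval_map_algebraMap, hz]
  set q : ℂ[X] := Lagrange.interpolate S id s
  have hq : ∀ z, aeval z p = 0 → eval z q = s z := fun z hz =>
    Lagrange.eval_interpolate_at_node (v := id) s (Set.injOn_id _) (hmem z hz)
  -- Averaging an interpolant with its conjugate makes the coefficients real.
  have hlift : C (1 / 2) * (q + q.map (starRingEnd ℂ)) ∈ lifts (algebraMap ℝ ℂ) := by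
    rw [lifts_iff_coeff_lifts]
    intro n
    refine ⟨(q.coeff n).re, ?_⟩
    rw [coeff_C_mul, coeff_add, coeff_map, Complex.add_conj, Complex.coe_algebraMap]
    push_cast
    ring
  obtain ⟨r, hr⟩ := hlift
  refine ⟨r, fun z hz => ?_⟩
  have hz' : aeval (starRingEnd ℂ z) p = 0 := by rw [aeval_conj, hz, map_zero]
  have h1 : eval z (q.map (starRingEnd ℂ)) = s z := by
    have := eval_map_apply (f := starRingEnd ℂ) (p := q) (starRingEnd ℂ z)
    rw [Complex.conj_conj, hq _ hz', hs z hz, Complex.conj_conj] at this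
    exact this
  rw [← eval_map_algebraMap]
  change map (algebraMap ℝ ℂ) r = _ at hr
  rw [hr, eval_mul, eval_C, eval_add, h1, hq z hz]
  ring

open Polynomial in
/-- If `p` has no root in `(-∞, 0]`, then `X` is a square modulo `p`. The principal square root,
interpolated at the complex roots of `p`, is a square root modulo the radical of `p`, and Newton's
iteration lifts it to a square root modulo `p`. -/
theorem exists_dvd_sq_sub_X {p : ℝ[X]} (hp : p ≠ 0) (h : ∀ μ : ℝ, μ ≤ 0 → eval μ p ≠ 0) :
    ∃ r : ℝ[X], p ∣ r * r - X := by
  have hslit : ∀ z : ℂ, aeval z p = 0 → z ∈ Complex.slitPlane := by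
    intro z hz
    by_contra hn
    rw [Complex.mem_slitPlane_iff] at hn
    push Not at hn
    have hz' : z = algebraMap ℝ ℂ z.re := Complex.ext (by simp) (by simp [hn.2])
    rw [hz', aeval_algebraMap_apply, Complex.coe_algebraMap, Complex.ofReal_eq_zero] at hz
    exact h z.re hn.1 (by simpa using hz)
  obtain ⟨r, hr⟩ := exists_real_interpolation hp (fun z => z ^ (1 / 2 : ℂ)) fun z hz => by
    have := Complex.conj_cpow z (1 / 2) (Complex.mem_slitPlane_iff_arg.1 (hslit z hz)).1
    rwa [map_div₀, map_one, map_ofNat] at this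
  have hsq : ∀ z : ℂ, aeval z p = 0 → aeval z r * aeval z r = z := by
    intro z hz
    have hz0 : z ≠ 0 := (Complex.mem_slitPlane_iff_arg.1 (hslit z hz)).2
    rw [hr z hz, ← Complex.cpow_add _ _ hz0]
    norm_num
  have hnil : IsNilpotent (aeval (AdjoinRoot.mk p r) (X * X - C (AdjoinRoot.root p))) := by
    refine ⟨p.natDegree, ?_⟩
    have := dvd_pow_of_forall_aeval_eq_zero (q := r * r - X) hp fun z hz => by
      simp [hsq z hz]
    rw [← AdjoinRoot.mk_eq_zero] at this
    simpa using this
  have hcop : IsCoprime p r := by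
    rw [isCoprime_iff_aeval_ne_zero_of_isAlgClosed ℝ ℂ]
    intro z
    by_contra! hz
    have h1 := hsq z hz.1
    rw [hz.2, mul_zero] at h1
    exact (Complex.mem_slitPlane_iff_arg.1 (hslit z hz.1)).2 h1.symm
  have hunit_r : IsUnit (AdjoinRoot.mk p r) := by
    obtain ⟨a, b, hab⟩ := hcop
    have := congrArg (AdjoinRoot.mk p) hab
    rw [map_add, map_mul, map_mul, AdjoinRoot.mk_self, mul_zero, zero_add, map_one] at this
    exact IsUnit.of_mul_eq_one_right _ this
  have hunit : IsUnit (aeval (AdjoinRoot.mk p r)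
      (derivative (X * X - C (AdjoinRoot.root p)))) := by
    have h2 : IsUnit (algebraMap ℝ (AdjoinRoot p) 2) :=
      (isUnit_iff_ne_zero.2 (two_ne_zero' ℝ)).map _
    have := h2.mul hunit_r
    rw [map_ofNat, two_mul] at this
    simpa using this
  obtain ⟨t, ⟨-, ht⟩, -⟩ := existsUnique_nilpotent_sub_and_aeval_eq_zero hnil hunit
  obtain ⟨s, rfl⟩ := AdjoinRoot.mk_surjective t
  refine ⟨s, ?_⟩
  rw [← AdjoinRoot.mk_eq_zero]
  simpa using ht

open Polynomial in
/-- A real matrix without eigenvalues in `(-∞, 0]` has a square root that is a polynomial in it. -/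
theorem exists_aeval_mul_self_eq {n : Type*} [Fintype n] [DecidableEq n] (A : Matrix n n ℝ)
    (h : ∀ μ : ℝ, μ ≤ 0 → eval μ A.charpoly ≠ 0) : ∃ r : ℝ[X], aeval A r * aeval A r = A := by
  obtain ⟨r, q, hq⟩ := exists_dvd_sq_sub_X A.charpoly_monic.ne_zero h
  refine ⟨r, ?_⟩
  have := congrArg (aeval A) hq
  rwa [map_mul, Matrix.aeval_self_charpoly, zero_mul, map_sub, map_mul, aeval_X,
    sub_eq_zero] at this

open Polynomial in
theorem Matrix.exists_mulVec_eq_smul_of_eval_charpoly {n : Type*} [Fintype n] [DecidableEq n]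
    {A : Matrix n n ℝ} {μ : ℝ} (h : eval μ A.charpoly = 0) :
    ∃ v, v ≠ 0 ∧ A.mulVec v = μ • v := by
  rw [Matrix.eval_charpoly] at h
  obtain ⟨v, hv, hv'⟩ := Matrix.exists_mulVec_eq_zero_iff.2 h
  refine ⟨v, hv, ?_⟩
  rw [Matrix.sub_mulVec, Matrix.scalar_apply, ← Matrix.smul_one_eq_diagonal, Matrix.smul_mulVec,
    Matrix.one_mulVec, sub_eq_zero] at hv'
  exact hv'.symm

open Polynomial in
/-- A polynomial in a `g`-self-adjoint matrix is `g`-self-adjoint. -/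
theorem Matrix.isSymm_mul_aeval {n : Type*} [Fintype n] [DecidableEq n] {g A : Matrix n n ℝ}
    (hg : g.IsSymm) (hA : (g * A).IsSymm) (p : ℝ[X]) : (g * aeval A p).IsSymm := by
  have hA' : A.transpose * g = g * A := by
    have := hA.eq
    rwa [Matrix.transpose_mul, hg.eq] at this
  have key : (aeval A p).transpose * g = g * aeval A p := by
    induction p using Polynomial.induction_on' with
    | add p q hp hq => rw [map_add, Matrix.transpose_add, add_mul, mul_add, hp, hq]
    | monomial k a =>
      have hk : (A ^ k).transpose * g = g * A ^ k := by
        rw [Matrix.transpose_pow]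
        exact (SemiconjBy.pow_right (show SemiconjBy g A A.transpose from hA'.symm) k).symm
      rw [aeval_monomial, Algebra.algebraMap_eq_smul_one, smul_mul_assoc, one_mul,
        Matrix.transpose_smul, smul_mul_assoc, hk, mul_smul_comm]
  rw [Matrix.IsSymm, Matrix.transpose_mul, hg.eq, key]

/-! ### Lorentzian forms -/

theorem IsLorentzMetric.isSymm {D : ℕ} {g : Matrix (Fin D) (Fin D) ℝ} (hg : IsLorentzMetric g) :
    g.IsSymm := by
  obtain ⟨h, -⟩ := hg
  rwa [Matrix.IsHermitian, Matrix.conjTranspose_eq_transpose_of_trivial] at h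

theorem IsLorentzMetric.isUnit_det {D : ℕ} {g : Matrix (Fin D) (Fin D) ℝ}
    (hg : IsLorentzMetric g) : IsUnit g.det := by
  obtain ⟨h, i₀, hneg, hpos⟩ := hg
  rw [isUnit_iff_ne_zero, h.det_eq_prod_eigenvalues, Finset.prod_ne_zero_iff]
  intro i _
  rcases eq_or_ne i i₀ with rfl | hi
  · exact_mod_cast hneg.ne
  · exact_mod_cast (hpos i hi).ne'

/-- Sylvester's law of inertia for Lorentzian metrics: an orthonormal coframe exists. -/
theorem IsLorentzMetric.exists_transpose_mul_mul_eq {D : ℕ} {g : Matrix (Fin D) (Fin D) ℝ}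
    (hg : IsLorentzMetric g) :
    ∃ E : Matrix (Fin D) (Fin D) ℝ, E.transpose * minkowski D * E = g := by
  obtain ⟨h, i₀, hneg, hpos⟩ := hg
  let U : Matrix (Fin D) (Fin D) ℝ := h.eigenvectorUnitary
  have hU : g = U * Matrix.diagonal h.eigenvalues * U.transpose := by
    have := h.spectral_theorem
    rw [Unitary.conjStarAlgAut_apply] at this
    exact this
  -- The eigenvalue that is negative is moved to position `0`.
  let σ : Fin D ≃ Fin D := Equiv.swap ⟨0, i₀.pos⟩ i₀
  refine ⟨Matrix.of fun A μ => √|h.eigenvalues (σ A)| * U μ (σ A), ?_⟩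
  have hη : ∀ A : Fin D, (if (A : ℕ) = 0 then (-1 : ℝ) else 1) * |h.eigenvalues (σ A)| =
      h.eigenvalues (σ A) := by
    intro A
    split_ifs with hA
    · have : σ A = i₀ := by
        rw [show A = ⟨0, i₀.pos⟩ from Fin.ext hA]
        exact Equiv.swap_apply_left _ _
      rw [this, abs_of_neg hneg]
      ring
    · have : σ A ≠ i₀ := by
        intro hc
        have h0 : A = ⟨0, i₀.pos⟩ :=
          σ.injective (hc.trans (Equiv.swap_apply_left _ _).symm)
        exact hA (by rw [h0])
      rw [abs_of_pos (hpos _ this), one_mul]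
  ext μ ν
  conv_rhs => rw [hU]
  rw [Matrix.mul_apply, Matrix.mul_apply, ← Equiv.sum_comp σ fun i =>
    (U * Matrix.diagonal h.eigenvalues) μ i * U.transpose i ν]
  refine Finset.sum_congr rfl fun A _ => ?_
  rw [minkowski, Matrix.mul_diagonal, Matrix.mul_diagonal, Matrix.transpose_apply,
    Matrix.transpose_apply, Matrix.of_apply, Matrix.of_apply]
  have h1 := Real.mul_self_sqrt (abs_nonneg (h.eigenvalues (σ A)))
  have h2 := hη A
  linear_combination (U μ (σ A) * U ν (σ A)) * h2 +
    (U μ (σ A) * U ν (σ A)) * (if (A : ℕ) = 0 then (-1 : ℝ) else 1) * h1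

open Matrix in
theorem dotProduct_minkowski_mulVec_pos {D : ℕ} {u : Fin D → ℝ}
    (h0 : ∀ A : Fin D, (A : ℕ) = 0 → u A = 0) (hu : u ≠ 0) : 0 < u ⬝ᵥ (minkowski D *ᵥ u) := by
  have hterm : ∀ A, u A * (minkowski D *ᵥ u) A = u A ^ 2 := by
    intro A
    rw [minkowski, Matrix.mulVec_diagonal]
    split_ifs with hA
    · rw [h0 A hA]
      ring
    · ring
  obtain ⟨B, hB⟩ := Function.ne_iff.1 hu
  refine Finset.sum_pos' (fun A _ => ?_) ⟨B, Finset.mem_univ B, ?_⟩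
  · rw [hterm]
    positivity
  · rw [hterm]
    have : u B ≠ 0 := hB
    positivity

open Matrix in
/-- Every two-dimensional subspace contains a spacelike vector: a vector of the subspace whose time
component vanishes. -/
theorem IsLorentzMetric.exists_pos {D : ℕ} {g : Matrix (Fin D) (Fin D) ℝ}
    (hg : IsLorentzMetric g) {v w : Fin D → ℝ}
    (hvw : ∀ a b : ℝ, a • v + b • w = 0 → a = 0 ∧ b = 0) :
    ∃ a b : ℝ, 0 < (a • v + b • w) ⬝ᵥ (g *ᵥ (a • v + b • w)) := by
  obtain ⟨E, hE⟩ := hg.exists_transpose_mul_mul_eq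
  have hdet : IsUnit E.det := by
    have := hg.isUnit_det
    rw [← hE, Matrix.det_mul] at this
    exact isUnit_of_mul_isUnit_right this
  obtain ⟨-, i₀, -⟩ := hg
  let o : Fin D := ⟨0, i₀.pos⟩
  have key : ∀ a b : ℝ, a * (E *ᵥ v) o + b * (E *ᵥ w) o = 0 → a • v + b • w ≠ 0 →
      0 < (a • v + b • w) ⬝ᵥ (g *ᵥ (a • v + b • w)) := by
    intro a b hab hne
    rw [← hE, ← Matrix.mulVec_mulVec, ← Matrix.mulVec_mulVec, Matrix.dotProduct_mulVec,
      Matrix.vecMul_transpose]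
    apply dotProduct_minkowski_mulVec_pos
    · intro A hA
      rw [show A = o from Fin.ext hA, Matrix.mulVec_add, Matrix.mulVec_smul, Matrix.mulVec_smul]
      exact hab
    · intro hc
      apply hne
      exact (Matrix.mulVec_injective_iff_isUnit.2 ((Matrix.isUnit_iff_isUnit_det E).2 hdet))
        (by rw [hc, Matrix.mulVec_zero])
  by_cases hv : (E *ᵥ v) o = 0
  · refine ⟨1, 0, key 1 0 (by rw [hv]; ring) fun hc => ?_⟩
    exact one_ne_zero (hvw 1 0 hc).1
  · refine ⟨(E *ᵥ w) o, -(E *ᵥ v) o, key _ _ (by ring) fun hc => ?_⟩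
    exact hv (neg_eq_zero.1 (hvw _ _ hc).2)

open Matrix in
theorem Matrix.IsSymm.dotProduct_mulVec_comm {n : Type*} [Fintype n] {g : Matrix n n ℝ}
    (hg : g.IsSymm) (u v : n → ℝ) : u ⬝ᵥ (g *ᵥ v) = v ⬝ᵥ (g *ᵥ u) := by
  rw [Matrix.dotProduct_mulVec, dotProduct_comm, ← Matrix.mulVec_transpose, hg.eq]

open Matrix in
/-- The orthogonal complement of a timelike vector is spacelike, since a plane spanned by orthogonal
vectors that are not spacelike would contain no spacelike vector. -/
theorem IsLorentzMetric.pos_of_orthogonal {D : ℕ} {g : Matrix (Fin D) (Fin D) ℝ}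
    (hg : IsLorentzMetric g) {t y : Fin D → ℝ} (ht : t ⬝ᵥ (g *ᵥ t) < 0)
    (hty : t ⬝ᵥ (g *ᵥ y) = 0) (hy : y ≠ 0) : 0 < y ⬝ᵥ (g *ᵥ y) := by
  have hyt : y ⬝ᵥ (g *ᵥ t) = 0 := by rw [hg.isSymm.dotProduct_mulVec_comm, hty]
  have hind : ∀ a b : ℝ, a • t + b • y = 0 → a = 0 ∧ b = 0 := by
    intro a b hab
    have h1 : (a • t + b • y) ⬝ᵥ (g *ᵥ t) = 0 := by rw [hab, zero_dotProduct]
    rw [add_dotProduct, smul_dotProduct, smul_dotProduct, hyt, smul_zero, add_zero,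
      smul_eq_mul] at h1
    have ha : a = 0 := (mul_eq_zero.1 h1).resolve_right ht.ne
    refine ⟨ha, ?_⟩
    rw [ha, zero_smul, zero_add] at hab
    exact (smul_eq_zero.1 hab).resolve_right hy
  obtain ⟨a, b, hab⟩ := hg.exists_pos hind
  simp only [mulVec_add, mulVec_smul, add_dotProduct, dotProduct_add, smul_dotProduct,
    dotProduct_smul, hty, hyt, smul_eq_mul, mul_zero, add_zero, zero_add] at hab
  by_contra hn
  nlinarith [mul_self_nonneg a, mul_self_nonneg b]

/-! ### Self-adjoint square roots -/

open Matrix in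
/-- If a `g`-self-adjoint matrix `A` acts as the scalar `μ < 0` on a plane with `g`-orthonormal basis
`K`, of signature `(-, +)`, and has no eigenvalue in `(-∞, 0]` on the orthogonal complement, then it
has a `g`-self-adjoint square root: it suffices to join `√(-μ)` times the `g`-self-adjoint complex
structure of the plane to the principal square root on the orthogonal complement. -/
theorem exists_isSymm_sqrt_of_plane {n : Type*} [Fintype n] [DecidableEq n] {g A : Matrix n n ℝ}
    (hg : g.IsSymm) (hA : (g * A).IsSymm) {μ : ℝ} (hμ : μ < 0) {K : Matrix n (Fin 2) ℝ}
    (hK : Kᵀ * g * K = !![-1, 0; 0, 1]) (hAK : A * K = μ • K)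
    (hpos : ∀ ν : ℝ, ν ≤ 0 → ∀ y, Kᵀ *ᵥ (g *ᵥ y) = 0 → A *ᵥ y = ν • y → y = 0) :
    ∃ γ, γ * γ = A ∧ (g * γ).IsSymm := by
  set h : Matrix (Fin 2) (Fin 2) ℝ := !![-1, 0; 0, 1] with hh
  set j : Matrix (Fin 2) (Fin 2) ℝ := !![0, 1; 1, 0] with hj
  have hhh : h * h = 1 := by
    ext a b
    fin_cases a <;> fin_cases b <;> simp [hh]
  have hjhj : j * h * j = -h := by
    ext a b
    fin_cases a <;> fin_cases b <;> simp [hh, hj]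
  have hhT : hᵀ = h := by
    ext a b
    fin_cases a <;> fin_cases b <;> simp [hh]
  have hjT : jᵀ = j := by
    ext a b
    fin_cases a <;> fin_cases b <;> simp [hj]
  have hAT : Aᵀ * g = g * A := by
    have := hA.eq
    rwa [transpose_mul, hg.eq] at this
  have hKA : Kᵀ * g * A = μ • (Kᵀ * g) := by
    rw [Matrix.mul_assoc, ← hAT, ← Matrix.mul_assoc, ← transpose_mul, hAK, transpose_smul,
      Matrix.smul_mul]
  have hsand : ∀ a b : Matrix (Fin 2) (Fin 2) ℝ,
      (K * a * (Kᵀ * g)) * (K * b * (Kᵀ * g)) = K * (a * h * b) * (Kᵀ * g) := by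
    intro a b
    rw [← hK]
    simp only [Matrix.mul_assoc]
  have hsymm : ∀ a : Matrix (Fin 2) (Fin 2) ℝ, aᵀ = a → (g * (K * a * (Kᵀ * g))).IsSymm := by
    intro a ha
    rw [IsSymm]
    simp only [transpose_mul, transpose_transpose, ha, hg.eq, Matrix.mul_assoc]
  -- `P` is the orthogonal projection onto the plane, `J` the complex structure.
  set P := K * h * (Kᵀ * g) with hP
  set J := K * j * (Kᵀ * g) with hJ
  have hPP : P * P = P := by rw [hP, hsand, hhh, Matrix.one_mul]
  have hJP : J * P = J := by rw [hJ, hP, hsand, Matrix.mul_assoc j, hhh, Matrix.mul_one]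
  have hPJ : P * J = J := by rw [hJ, hP, hsand, hhh, Matrix.one_mul]
  have hJJ : J * J = -P := by
    rw [hJ, hP, hsand, hjhj, Matrix.mul_neg, Matrix.neg_mul]
  have hAP : A * P = μ • P := by
    rw [hP, Matrix.mul_assoc K, ← Matrix.mul_assoc A, hAK, Matrix.smul_mul]
  have hPA : P * A = μ • P := by
    rw [hP, Matrix.mul_assoc, hKA, Matrix.mul_smul]
  have hgP : (g * P).IsSymm := hsymm h hhT
  have hgJ : (g * J).IsSymm := hsymm j hjT
  -- `B` agrees with `A` on the orthogonal complement and with `-A` on the plane.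
  set B := A - (2 * μ) • P with hB
  have hBP : B * P = (-μ) • P := by
    rw [hB, Matrix.sub_mul, hAP, Matrix.smul_mul, hPP, ← sub_smul]
    congr 1
    ring
  have hPB : P * B = (-μ) • P := by
    rw [hB, Matrix.mul_sub, hPA, Matrix.mul_smul, hPP, ← sub_smul]
    congr 1
    ring
  have hgB : (g * B).IsSymm := by
    rw [hB, Matrix.mul_sub, Matrix.mul_smul]
    exact hA.sub (hgP.smul _)
  have hspec : ∀ ν : ℝ, ν ≤ 0 → Polynomial.eval ν B.charpoly ≠ 0 := by
    intro ν hν hroot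
    obtain ⟨y, hy, hBy⟩ := exists_mulVec_eq_smul_of_eval_charpoly hroot
    have hPy : P *ᵥ y = 0 := by
      have h1 : P *ᵥ (B *ᵥ y) = (-μ) • (P *ᵥ y) := by rw [mulVec_mulVec, hPB, smul_mulVec]
      rw [hBy, mulVec_smul, ← sub_eq_zero, ← sub_smul] at h1
      exact (smul_eq_zero.1 h1).resolve_left (by linarith)
    have hKy : Kᵀ *ᵥ (g *ᵥ y) = 0 := by
      have h1 : Kᵀ * g * P = Kᵀ * g := by
        rw [hP, Matrix.mul_assoc K, ← Matrix.mul_assoc (Kᵀ * g), hK, ← Matrix.mul_assoc h h,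
          hhh, Matrix.one_mul]
      rw [mulVec_mulVec, ← h1, ← mulVec_mulVec, hPy, mulVec_zero]
    refine hy (hpos ν hν y hKy ?_)
    rw [← hBy, hB, sub_mulVec, smul_mulVec, hPy, smul_zero, sub_zero]
  obtain ⟨r, hr⟩ := exists_aeval_mul_self_eq B hspec
  set S := Polynomial.aeval B r with hS
  have hgS : (g * S).IsSymm := isSymm_mul_aeval hg hgB r
  have hPS : P * S = S * P :=
    Algebra.commute_of_mem_adjoin_singleton_of_commute
      (Polynomial.aeval_mem_adjoin_singleton ℝ B) (hPB.trans hBP.symm)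
  refine ⟨√(-μ) • J + S * (1 - P), ?_, ?_⟩
  · have h1 : J * (S * (1 - P)) = 0 := by
      rw [Matrix.mul_sub, Matrix.mul_one, ← hPS, Matrix.mul_sub, ← Matrix.mul_assoc, hJP, sub_self]
    have h2 : S * (1 - P) * J = 0 := by
      rw [Matrix.mul_assoc, Matrix.sub_mul, Matrix.one_mul, hPJ, sub_self, Matrix.mul_zero]
    have h3 : S * (1 - P) * (S * (1 - P)) = B * (1 - P) := by
      have h4 : (1 - P) * S = S * (1 - P) := by
        rw [Matrix.sub_mul, Matrix.mul_sub, hPS, Matrix.one_mul, Matrix.mul_one]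
      have h5 : (1 - P) * (1 - P) = 1 - P := by
        rw [Matrix.sub_mul, Matrix.one_mul, Matrix.mul_sub, hPP, Matrix.mul_one, sub_self, sub_zero]
      rw [Matrix.mul_assoc, ← Matrix.mul_assoc (1 - P), h4, Matrix.mul_assoc S (1 - P), h5,
        ← Matrix.mul_assoc, hr]
    rw [Matrix.mul_add, Matrix.add_mul, Matrix.add_mul, Matrix.smul_mul, Matrix.smul_mul,
      Matrix.mul_smul, Matrix.mul_smul, h1, h2, h3, hJJ, smul_zero, add_zero, zero_add, smul_smul,
      Real.mul_self_sqrt (by linarith), Matrix.mul_sub, Matrix.mul_one, hBP, hB]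
    module
  · have h6 : (g * (S * P)).IsSymm := by
      have hST : Sᵀ * g = g * S := by
        have := hgS.eq
        rwa [transpose_mul, hg.eq] at this
      have hPT : Pᵀ * g = g * P := by
        have := hgP.eq
        rwa [transpose_mul, hg.eq] at this
      rw [IsSymm, transpose_mul, transpose_mul, hg.eq, Matrix.mul_assoc, hST, ← Matrix.mul_assoc,
        hPT, Matrix.mul_assoc, hPS]
    rw [Matrix.mul_add, Matrix.mul_smul, Matrix.mul_sub, Matrix.mul_one, Matrix.mul_sub]
    exact (hgJ.smul _).add (hgS.sub h6)

open Matrix in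
/-- If `f = μ g` with `μ < 0` on a plane, then `g` has signature `(-, +)` there: the plane contains a
vector spacelike for `g` and one spacelike for `f`, which is timelike for `g`. -/
theorem exists_orthonormal_of_eq_smul {D : ℕ} {g f : Matrix (Fin D) (Fin D) ℝ}
    (hg : IsLorentzMetric g) (hf : IsLorentzMetric f) {μ : ℝ} (hμ : μ < 0) {v w : Fin D → ℝ}
    (hv : f *ᵥ v = μ • g *ᵥ v) (hw : f *ᵥ w = μ • g *ᵥ w)
    (hvw : ∀ a b : ℝ, a • v + b • w = 0 → a = 0 ∧ b = 0) :
    ∃ t x : Fin D → ℝ, f *ᵥ t = μ • g *ᵥ t ∧ f *ᵥ x = μ • g *ᵥ x ∧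
      t ⬝ᵥ (g *ᵥ t) = -1 ∧ x ⬝ᵥ (g *ᵥ x) = 1 ∧ t ⬝ᵥ (g *ᵥ x) = 0 := by
  have hcomb : ∀ {u u' : Fin D → ℝ}, f *ᵥ u = μ • g *ᵥ u → f *ᵥ u' = μ • g *ᵥ u' → ∀ a b : ℝ,
      f *ᵥ (a • u + b • u') = μ • g *ᵥ (a • u + b • u') := by
    intro u u' hu hu' a b
    simp only [mulVec_add, mulVec_smul, hu, hu']
    module
  obtain ⟨a, b, hx⟩ := hg.exists_pos hvw
  obtain ⟨c, d, ht⟩ := hf.exists_pos hvw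
  have hfx := hcomb hv hw a b
  have hft := hcomb hv hw c d
  set x := a • v + b • w
  set t := c • v + d • w
  rw [hft, dotProduct_smul, smul_eq_mul] at ht
  have ht' : t ⬝ᵥ (g *ᵥ t) < 0 := by
    by_contra! hn
    exact ht.not_ge (mul_nonpos_of_nonpos_of_nonneg hμ.le hn)
  -- Gram-Schmidt, starting from the spacelike vector.
  set q := x ⬝ᵥ (g *ᵥ x) with hq
  set m := t ⬝ᵥ (g *ᵥ x) with hm
  have hm' : x ⬝ᵥ (g *ᵥ t) = m := hg.isSymm.dotProduct_mulVec_comm _ _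
  have hfs := hcomb hft hfx 1 (-(m / q))
  set s := (1 : ℝ) • t + (-(m / q)) • x with hs
  have hsx : s ⬝ᵥ (g *ᵥ x) = 0 := by
    rw [hs, add_dotProduct, smul_dotProduct, smul_dotProduct, ← hm, ← hq, smul_eq_mul, smul_eq_mul]
    field_simp
    ring
  have hss : s ⬝ᵥ (g *ᵥ s) < 0 := by
    have : s ⬝ᵥ (g *ᵥ s) = t ⬝ᵥ (g *ᵥ t) - m ^ 2 / q := by
      rw [hs]
      simp only [mulVec_add, mulVec_smul, add_dotProduct, dotProduct_add, smul_dotProduct,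
        dotProduct_smul, smul_eq_mul, ← hm, hm', ← hq]
      field_simp
      ring
    have h2 : 0 ≤ m ^ 2 / q := by positivity
    linarith
  set p := s ⬝ᵥ (g *ᵥ s) with hp
  have h1 : √(-p) ≠ 0 := (Real.sqrt_pos.2 (by linarith)).ne'
  have h2 : √q ≠ 0 := (Real.sqrt_pos.2 hx).ne'
  have h3 : √(-p) * √(-p) = -p := Real.mul_self_sqrt (by linarith)
  have h4 : √q * √q = q := Real.mul_self_sqrt hx.le
  refine ⟨(√(-p))⁻¹ • s, (√q)⁻¹ • x, ?_, ?_, ?_, ?_, ?_⟩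
  · rw [mulVec_smul, mulVec_smul, hfs, smul_comm]
  · rw [mulVec_smul, mulVec_smul, hfx, smul_comm]
  · rw [mulVec_smul, dotProduct_smul, smul_dotProduct, ← hp, smul_eq_mul, smul_eq_mul]
    field_simp
    linear_combination h3
  · rw [mulVec_smul, dotProduct_smul, smul_dotProduct, ← hq, smul_eq_mul, smul_eq_mul]
    field_simp
    linear_combination -h4
  · rw [mulVec_smul, dotProduct_smul, smul_dotProduct, hsx, smul_zero, smul_zero]

open Matrix in
/-- A real square root of `g⁻¹ f` can be traded for a `g`-self-adjoint one. -/
theorem exists_isSymm_sqrt {D : ℕ} {g f : Matrix (Fin D) (Fin D) ℝ} (hg : IsLorentzMetric g)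
    (hf : IsLorentzMetric f) {γ : Matrix (Fin D) (Fin D) ℝ} (hγ : γ * γ = g⁻¹ * f) :
    ∃ γ', γ' * γ' = g⁻¹ * f ∧ (g * γ').IsSymm := by
  set A := g⁻¹ * f with hA
  have hgA : g * A = f := by rw [hA, Matrix.mul_nonsing_inv_cancel_left _ _ hg.isUnit_det]
  have hgA' : (g * A).IsSymm := hgA ▸ hf.isSymm
  have hfv : ∀ (ν : ℝ) (u : Fin D → ℝ), A *ᵥ u = ν • u → f *ᵥ u = ν • g *ᵥ u := by
    intro ν u hu
    rw [← hgA, ← mulVec_mulVec, hu, mulVec_smul]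
  by_cases hspec : ∀ μ : ℝ, μ ≤ 0 → Polynomial.eval μ A.charpoly ≠ 0
  · obtain ⟨r, hr⟩ := exists_aeval_mul_self_eq A hspec
    exact ⟨_, hr, isSymm_mul_aeval hg.isSymm hgA' r⟩
  push Not at hspec
  obtain ⟨μ, hμ, hroot⟩ := hspec
  obtain ⟨v, hv, hAv⟩ := exists_mulVec_eq_smul_of_eval_charpoly hroot
  have hμ : μ < 0 := by
    refine lt_of_le_of_ne hμ ?_
    rintro rfl
    have h1 := hfv 0 v hAv
    rw [zero_smul] at h1
    exact hf.isUnit_det.ne_zero (Matrix.exists_mulVec_eq_zero_iff.1 ⟨v, hv, h1⟩)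
  -- A second eigenvector: a real eigenvector of `γ` would have a nonnegative eigenvalue for `A`.
  have hγγ : γ *ᵥ (γ *ᵥ v) = μ • v := by rw [mulVec_mulVec, hγ, hAv]
  have hAw : A *ᵥ (γ *ᵥ v) = μ • (γ *ᵥ v) := by
    rw [← hγ, ← mulVec_mulVec, hγγ, mulVec_smul]
  have hind : ∀ a b : ℝ, a • v + b • (γ *ᵥ v) = 0 → a = 0 ∧ b = 0 := by
    intro a b hab
    have h1 : a • (γ *ᵥ v) + (b * μ) • v = 0 := by
      have := congrArg (γ *ᵥ ·) hab
      simpa only [mulVec_add, mulVec_smul, hγγ, mulVec_zero, smul_smul] using this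
    have h2 : (a ^ 2 - b ^ 2 * μ) • v = 0 := by
      have : (a ^ 2 - b ^ 2 * μ) • v =
          a • (a • v + b • (γ *ᵥ v)) - b • (a • (γ *ᵥ v) + (b * μ) • v) := by module
      rw [this, hab, h1, smul_zero, smul_zero, sub_zero]
    have h3 := (smul_eq_zero.1 h2).resolve_right hv
    have h4 : 0 ≤ b ^ 2 * (-μ) := mul_nonneg (sq_nonneg b) (by linarith)
    have ha : a ^ 2 = 0 := le_antisymm (by linarith) (sq_nonneg a)
    have hb : b ^ 2 * μ = 0 := by linarith
    exact ⟨pow_eq_zero_iff two_ne_zero |>.1 ha,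
      pow_eq_zero_iff two_ne_zero |>.1 ((mul_eq_zero.1 hb).resolve_right hμ.ne)⟩
  obtain ⟨t, x, hft, hfx, htt, hxx, htx⟩ :=
    exists_orthonormal_of_eq_smul hg hf hμ (hfv μ v hAv) (hfv μ _ hAw) hind
  have hxt : x ⬝ᵥ (g *ᵥ t) = 0 := by rw [hg.isSymm.dotProduct_mulVec_comm, htx]
  have hAof : ∀ u, f *ᵥ u = μ • g *ᵥ u → A *ᵥ u = μ • u := by
    intro u hu
    rw [hA, ← mulVec_mulVec, hu, mulVec_smul, mulVec_mulVec, nonsing_inv_mul _ hg.isUnit_det,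
      one_mulVec]
  have hKT : ∀ (u : Fin D → ℝ) (i : Fin 2), ((of ![t, x]) *ᵥ u) i = ![t, x] i ⬝ᵥ u :=
    fun _ _ => rfl
  refine exists_isSymm_sqrt_of_plane (K := (of ![t, x])ᵀ) hg.isSymm hgA' hμ ?_ ?_ ?_
  · rw [transpose_transpose, Matrix.mul_assoc]
    have : ∀ i k, ((of ![t, x]) * (g * (of ![t, x])ᵀ)) i k =
        ![t, x] i ⬝ᵥ (g *ᵥ ![t, x] k) := fun _ _ => rfl
    ext i k
    rw [this]
    fin_cases i <;> fin_cases k <;> simp [htt, hxx, htx, hxt]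
  · have : ∀ i k, (A * (of ![t, x])ᵀ) i k = (A *ᵥ ![t, x] k) i := fun _ _ => rfl
    ext i k
    rw [this]
    fin_cases k <;> simp [hAof t hft, hAof x hfx]
  · intro ν hν y hy hAy
    rw [transpose_transpose] at hy
    have hty : t ⬝ᵥ (g *ᵥ y) = 0 := congrFun hy 0
    have hxy : x ⬝ᵥ (g *ᵥ y) = 0 := congrFun hy 1
    -- `y` is orthogonal to `t`, timelike for `g`, and to `x`, timelike for `f`.
    by_contra hy0
    have hfy := hfv ν y hAy
    have h1 := hg.pos_of_orthogonal (by rw [htt]; norm_num) hty hy0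
    have h2 := hf.pos_of_orthogonal (t := x)
      (by rw [hfx, dotProduct_smul, hxx, smul_eq_mul, mul_one]; exact hμ)
      (by rw [hfy, dotProduct_smul, hxy, smul_zero]) hy0
    rw [hfy, dotProduct_smul, smul_eq_mul] at h2
    exact h2.not_ge (mul_nonpos_of_nonpos_of_nonneg hν h1.le)

/-! ### Vielbeins -/

theorem minkowski_mul_self (D : ℕ) : minkowski D * minkowski D = 1 := by
  rw [minkowski, Matrix.diagonal_mul_diagonal, ← Matrix.diagonal_one]
  congr 1
  ext A
  split_ifs <;> norm_num

theorem minkowski_transpose (D : ℕ) : (minkowski D).transpose = minkowski D :=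
  Matrix.diagonal_transpose _

open Matrix in
theorem sum_minkowski_eq {D : ℕ} (e : Matrix (Fin D) (Fin D) ℝ) (μ ν : Fin D) :
    ∑ A, ∑ B, minkowski D A B * e A μ * e B ν = (eᵀ * minkowski D * e) μ ν := by
  rw [Matrix.mul_apply, Finset.sum_comm]
  refine Finset.sum_congr rfl fun B _ => ?_
  rw [Matrix.mul_apply, Finset.sum_mul]
  refine Finset.sum_congr rfl fun A _ => ?_
  rw [transpose_apply]
  ring

open Matrix in
theorem isFrameOf_iff {D : ℕ} {e g : Matrix (Fin D) (Fin D) ℝ} :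
    IsFrameOf e g ↔ eᵀ * minkowski D * e = g⁻¹ := by
  simp only [IsFrameOf, sum_minkowski_eq]
  exact Matrix.ext_iff

open Matrix in
theorem isCoframeOf_iff {D : ℕ} {L f : Matrix (Fin D) (Fin D) ℝ} :
    IsCoframeOf L f ↔ Lᵀ * minkowski D * L = f := by
  simp only [IsCoframeOf, sum_minkowski_eq]
  exact Matrix.ext_iff

open Matrix in
theorem symmetricVielbeins_iff {D : ℕ} {e L : Matrix (Fin D) (Fin D) ℝ} :
    SymmetricVielbeins e L ↔ (minkowski D * (L * eᵀ)).IsSymm := by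
  have h : ∀ A B, ∑ μ, e A μ * lowered L B μ = (minkowski D * (L * eᵀ)) B A := by
    intro A B
    rw [← Matrix.mul_assoc, Matrix.mul_apply]
    refine Finset.sum_congr rfl fun μ _ => ?_
    rw [transpose_apply, mul_comm]
    rfl
  simp only [SymmetricVielbeins, h]
  exact (Matrix.ext_iff (M := (minkowski D * (L * eᵀ))ᵀ))

open Matrix in
/-- Symmetric vielbeins give the square root `e_A^μ L^A_ν`. -/
theorem mul_self_eq_of_symmetricVielbeins {D : ℕ} {e L g f : Matrix (Fin D) (Fin D) ℝ}
    (he : IsFrameOf e g) (hL : IsCoframeOf L f) (hs : SymmetricVielbeins e L) :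
    (eᵀ * L) * (eᵀ * L) = g⁻¹ * f := by
  rw [isFrameOf_iff] at he
  rw [isCoframeOf_iff] at hL
  rw [symmetricVielbeins_iff, IsSymm, transpose_mul, transpose_mul, transpose_transpose,
    minkowski_transpose] at hs
  have h1 : L * eᵀ = minkowski D * (e * Lᵀ * minkowski D) := by
    rw [hs, ← Matrix.mul_assoc, minkowski_mul_self, Matrix.one_mul]
  calc (eᵀ * L) * (eᵀ * L) = eᵀ * (L * eᵀ) * L := by simp only [Matrix.mul_assoc]
    _ = (eᵀ * minkowski D * e) * (Lᵀ * minkowski D * L) := by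
      rw [h1]
      simp only [Matrix.mul_assoc]
    _ = g⁻¹ * f := by rw [he, hL]

open Matrix in
/-- If `E` is an orthonormal coframe of `g` and `γ` is a `g`-self-adjoint square root, then `E γ` is
a coframe of `f` symmetric with respect to the frame dual to `E`. -/
theorem exists_symmetricVielbeins {D : ℕ} {g f γ : Matrix (Fin D) (Fin D) ℝ}
    (hg : IsLorentzMetric g) (hγ : γ * γ = g⁻¹ * f) (hgγ : (g * γ).IsSymm) :
    ∃ e L, IsFrameOf e g ∧ IsCoframeOf L f ∧ SymmetricVielbeins e L := by
  obtain ⟨E, hE⟩ := hg.exists_transpose_mul_mul_eq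
  have hdet : IsUnit E.det := by
    have := hg.isUnit_det
    rw [← hE, Matrix.det_mul] at this
    exact isUnit_of_mul_isUnit_right this
  have hγT : γᵀ * g = g * γ := by
    have := hgγ.eq
    rwa [transpose_mul, hg.isSymm.eq] at this
  have hη : (minkowski D)⁻¹ = minkowski D := Matrix.inv_eq_left_inv (minkowski_mul_self D)
  refine ⟨(E⁻¹)ᵀ, E * γ, ?_, ?_, ?_⟩
  · rw [isFrameOf_iff, ← hE, Matrix.mul_inv_rev, Matrix.mul_inv_rev, hη, transpose_transpose,
      transpose_nonsing_inv, Matrix.mul_assoc]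
  · rw [isCoframeOf_iff, transpose_mul]
    calc γᵀ * Eᵀ * minkowski D * (E * γ) = γᵀ * (Eᵀ * minkowski D * E) * γ := by
          simp only [Matrix.mul_assoc]
      _ = f := by
          rw [hE, hγT, Matrix.mul_assoc, hγ, Matrix.mul_nonsing_inv_cancel_left _ _ hg.isUnit_det]
  · rw [symmetricVielbeins_iff, transpose_transpose]
    have h1 : minkowski D * (E * γ * E⁻¹) = (E⁻¹)ᵀ * (g * γ) * E⁻¹ := by
      have h2 : (E⁻¹)ᵀ * Eᵀ = 1 := by
        rw [← transpose_mul, Matrix.mul_nonsing_inv _ hdet, transpose_one]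
      calc minkowski D * (E * γ * E⁻¹)
          = ((E⁻¹)ᵀ * Eᵀ) * (minkowski D * (E * γ * E⁻¹)) := by rw [h2, Matrix.one_mul]
        _ = (E⁻¹)ᵀ * ((Eᵀ * minkowski D * E) * γ) * E⁻¹ := by simp only [Matrix.mul_assoc]
        _ = (E⁻¹)ᵀ * (g * γ) * E⁻¹ := by rw [hE]
    rw [h1, IsSymm, transpose_mul, transpose_mul, hgγ.eq, transpose_transpose,
      Matrix.mul_assoc (E⁻¹)ᵀ]

theorem proposition7 (D : ℕ) (hD : D = 2 ∨ D = 3 ∨ D = 4)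
    (g f : Matrix (Fin D) (Fin D) ℝ) (hg : IsLorentzMetric g) (hf : IsLorentzMetric f) :
    ((∃ e L : Matrix (Fin D) (Fin D) ℝ,
        IsFrameOf e g ∧ IsCoframeOf L f ∧ SymmetricVielbeins e L) ↔
      ∃ γ : Matrix (Fin D) (Fin D) ℝ, γ * γ = g⁻¹ * f) ∧
    ((∃ γ : Matrix (Fin D) (Fin D) ℝ, γ * γ = g⁻¹ * f) ↔
      ∃ γ : Matrix (Fin D) (Fin D) ℝ, γ * γ = g⁻¹ * f ∧ (f * γ).IsSymm) := by
  refine ⟨⟨?_, ?_⟩, ⟨?_, ?_⟩⟩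
  · rintro ⟨e, L, he, hL, hs⟩
    exact ⟨_, mul_self_eq_of_symmetricVielbeins he hL hs⟩
  · rintro ⟨γ, hγ⟩
    obtain ⟨γ', hγ', hs⟩ := exists_isSymm_sqrt hg hf hγ
    exact exists_symmetricVielbeins hg hγ' hs
  · rintro ⟨γ, hγ⟩
    obtain ⟨γ', hγ', hs⟩ := exists_isSymm_sqrt hg hf hγ
    refine ⟨γ', hγ', ?_⟩
    -- `f γ = g γ³`, and `γ³` is a polynomial in the `g`-self-adjoint `γ`.
    have h1 : f * γ' = g * Polynomial.aeval γ' (Polynomial.X ^ 3 : Polynomial ℝ) := by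
      rw [map_pow, Polynomial.aeval_X, pow_three', hγ', ← Matrix.mul_assoc,
        Matrix.mul_nonsing_inv_cancel_left _ _ hg.isUnit_det]
    rw [h1]
    exact Matrix.isSymm_mul_aeval hg.isSymm hs _
  · rintro ⟨γ, hγ, -⟩
    exact ⟨γ, hγ⟩
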